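/- Let $N=(N(t))_{t\ge 0}$ be an inhomogeneous Poisson process with $N(0)=0$, with locally integrable intensity function $\lambda:[0,\infty)\to[0,\infty)$ and cumulative intensity $m(t)=\int_0^t\lambda(s)\,ds$, and let $T_1\le T_2\le\cdots$ be its arrival times. Let $X_0,X_1,X_2,\dots$ be nonnegative, identically distributed (not necessarily independent) random variables such that, for some $\alpha>0$, the tail $x\mapsto\mathbb P(X_1>x)$ is regularly varying at infinity with index $-\alpha$, i.e. $\mathbb P(X_1>cx)/\mathbb P(X_1>x)\to c^{-\alpha}$ as $x\to\infty$ for every $c>0$, and such that $$\sup_{i,j\ge1,\ i\ne j}\frac{\mathbb P(X_i>x,\,X_j>x)}{\mathbb P(X_1>x)}\longrightarrow0\qquad(x\to\infty).$$ Let $h_0,h_1,h_2,\dots$ be i.i.d. nonnegative measurable random functions $(t,v)\mapsto h_i(t,v)$, that is, $h_i(t,v)=h(\xi_i,t,v)$ with i.i.d. random elements $\xi_i$ of a measurable space $E$ and a function $h\ge0$ that is jointly measurable in $(e,v)\in E\times\mathbb R$ for each $t$. Assume that the sequence $(X_i)$, the sequence $(\xi_i)$ and the process $N$ are independent of each other.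 Let $$Y(t)=\sum_{i=1}^{N(t)}X_i\,h_i(t,T_i),\qquad t\ge0.$$ Fix $T\ge 0$ with $m(T)>0$ and assume that for some $p>\alpha$ one has $\mathbb E\big[h_i(T,T_i)^p\,\mathbf 1_{\{T_i\le T\}}\big]<\infty$ for all $i\ge1$. Then $\mathbb E[h_0^\alpha(T,V_0)]<\infty$ and $$\lim_{x\to\infty}\frac{\mathbb P(Y(T)>x)}{\mathbb P(X_1>x)}=m(T)\,\mathbb E\big[h_0^{\alpha}(T,V_0)\big],$$ where $V_0$ is independent of $h_0$ and has density $\lambda(t)/m(T)$ on $0\le t\le T$. -/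

import Mathlib

open MeasureTheory ProbabilityTheory Filter Topology
open scoped NNReal ENNReal

noncomputable section

namespace ShotNoise

/-- `f` is (eventually positive and) regularly varying at `+∞` with index `ρ`:
`f (c x) / f x → c ^ ρ` as `x → ∞`, for every `c > 0`. -/
def RegularlyVarying (f : ℝ → ℝ) (ρ : ℝ) : Prop :=
  (∀ᶠ x in atTop, 0 < f x) ∧
    ∀ c : ℝ, 0 < c → Tendsto (fun x => f (c * x) / f x) atTop (𝓝 (c ^ ρ))

/-- The cumulative intensity `m(t) = ∫₀ᵗ λ(s) ds` of an intensity function `lam`. -/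
def cumulativeIntensity (lam : ℝ → ℝ) (t : ℝ) : ℝ :=
  ∫ s in (0 : ℝ)..t, lam s

/-- `lam` is an intensity function on `[0, ∞)`: nonnegative and integrable on every `[0, t]`. -/
structure IsIntensity (lam : ℝ → ℝ) : Prop where
  nonneg : ∀ t : ℝ, 0 ≤ t → 0 ≤ lam t
  intervalIntegrable : ∀ t : ℝ, 0 ≤ t → IntervalIntegrable lam volume 0 t

variable {Ω : Type*} [MeasurableSpace Ω]

/-- `N` is an inhomogeneous Poisson (counting) process with intensity function `lam`: it starts
at `0`, its paths are nondecreasing and right-continuous (as functions into the discrete space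
`ℕ`), its increments are independent, and `N t - N s` is Poisson with mean `m(t) - m(s)`. -/
structure IsInhomogeneousPoissonProcess (N : ℝ≥0 → Ω → ℕ) (lam : ℝ → ℝ) (P : Measure Ω) :
    Prop where
  isIntensity : IsIntensity lam
  measurable : ∀ t, Measurable (N t)
  zero : ∀ᵐ ω ∂P, N 0 ω = 0
  monotone : ∀ᵐ ω ∂P, Monotone (fun t => N t ω)
  rightContinuous : ∀ᵐ ω ∂P, ∀ t, ContinuousWithinAt (fun s => N s ω) (Set.Ici t) t
  indepIncrements : HasIndepIncrements N P
  law : ∀ s t : ℝ≥0, s ≤ t →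
    HasLaw (fun ω => N t ω - N s ω)
      (poissonMeasure (cumulativeIntensity lam t - cumulativeIntensity lam s).toNNReal) P

/-- The `i`-th arrival time (`i ≥ 1`) of a counting process: the first time at which the count
reaches `i`. It is used only for `i` at most the count at some time, where the infimum is over a
nonempty set. -/
def arrivalTime (N : ℝ≥0 → Ω → ℕ) (i : ℕ) (ω : Ω) : ℝ≥0 :=
  sInf {t : ℝ≥0 | i ≤ N t ω}

/-- The shot noise process `Y(t) = ∑_{i=1}^{N(t)} X_i h_i(t, T_i)`. The random shock functions are
`h_i(t, v) = h (ξ_i) t v`, where `ξ_i` is a random element of a measurable space `E` which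
parametrizes the possible shock functions. -/
def shotNoise {E : Type*} (N : ℝ≥0 → Ω → ℕ) (X : ℕ → Ω → ℝ) (h : E → ℝ → ℝ → ℝ)
    (ξ : ℕ → Ω → E) (t : ℝ≥0) (ω : Ω) : ℝ :=
  ∑ i ∈ Finset.Icc 1 (N t ω), X i ω * h (ξ i ω) t (arrivalTime N i ω)

/-- The probability law on `ℝ` with density `λ(t) / m(T)` on `[0, T]`. -/
def shockTimeLaw (lam : ℝ → ℝ) (T : ℝ) : Measure ℝ :=
  (volume.restrict (Set.Icc 0 T)).withDensity
    (fun t => ENNReal.ofReal (lam t / cumulativeIntensity lam T))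

/-- Uniform bivariate upper tail independence of `X_1, X_2, …`. -/
def UniformTailIndependent (X : ℕ → Ω → ℝ) (P : Measure Ω) : Prop :=
  Tendsto
    (fun x : ℝ => ⨆ (i : ℕ) (j : ℕ) (_ : 1 ≤ i) (_ : 1 ≤ j) (_ : i ≠ j),
      P {ω | x < X i ω ∧ x < X j ω} / P {ω | x < X 1 ω})
    atTop (𝓝 0)

end ShotNoise

end

/-!
The tail of the shot noise is governed by the principle of a single big jump. The shocks `X` are
independent of the pair formed by the parameters `ξ` and the path of `N`, so this pair can be
frozen: `P(Y(T) > x)` is the average over `ω'` of `P(∑_{i ≤ n} X_i θ_i > x)`, where `n = N_T(ω')`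
and `θ_i = h(ξ_i(ω'), T, T_i(ω'))` are now deterministic (`integral_measureReal_frozen`).

For deterministic `n` and weights, asymptotic independence of the `X_i` makes the union of the
events `{X_i θ_i > x}` have asymptotically the sum of their probabilities. A sum that exceeds `x`
has either a single term of size nearly `x` or two terms of order `x`, and the latter is
negligible. With regular variation, the probability divided by `F(x) = P(X_1 > x)` tends to
`∑ θ_i ^ α` (`tendsto_tail_sum_div`).

The limit passes through the average over `ω'` by dominated convergence. The union bound together
with a Potter-type bound on `F(x / c) / F(x)` gives the majorant `∑_{i ≤ n} C n ^ k (1 + θ_i ^ p)`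
with `k ≥ p` (`tail_sum_le`, `RegularlyVarying.exists_forall_div_le`).

Both the integral of the majorant and the limit are computed by a form of Campbell's formula
weighted by the number of arrivals (`IsInhomogeneousPoissonProcess.lintegral_sum_arrivals`). It
rests on the fact that on `{N_T = n}` the arrivals have intensity measure `n P(N_T = n)` times the
law of `V_0` (`IsInhomogeneousPoissonProcess.sum_map_pathArrivalTime`), which is checked on
half-lines, where it reduces to the binomial theorem. The same formula on `{N_T = 1}` turns the
assumption on the first shock into finiteness of `E[h_0(T, V_0) ^ p]`.
-/

noncomputable section

namespace ShotNoise

/-! ### Regularly varying tails -/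

lemma RegularlyVarying.pos_of_antitone {F : ℝ → ℝ} {ρ : ℝ} (hF : RegularlyVarying F ρ)
    (hanti : Antitone F) (x : ℝ) : 0 < F x := by
  obtain ⟨y, hy, hxy⟩ := (hF.1.and (eventually_ge_atTop x)).exists
  exact hy.trans_le (hanti hxy)

/-- Eventually, halving the argument costs at most the factor `2 ^ p`, because the limiting factor
`2 ^ α` is smaller. -/
lemma RegularlyVarying.exists_le_two_rpow_mul {F : ℝ → ℝ} {α p : ℝ}
    (hF : RegularlyVarying F (-α)) (hp : α < p) :
    ∃ x₀ : ℝ, 0 < x₀ ∧ ∀ y, x₀ ≤ y → F y ≤ 2 ^ p * F (2 * y) := by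
  have hlt : (2 : ℝ) ^ (-p) < 2 ^ (-α) :=
    Real.rpow_lt_rpow_of_exponent_lt (by norm_num) (by linarith)
  have h := (hF.2 2 (by norm_num)).eventually (lt_mem_nhds hlt)
  obtain ⟨x₀, hx₀⟩ := eventually_atTop.1 (h.and hF.1)
  refine ⟨max x₀ 1, by positivity, fun y hy => ?_⟩
  obtain ⟨h1, h2⟩ := hx₀ y ((le_max_left _ _).trans hy)
  rw [lt_div_iff₀ h2] at h1
  have hpos : (0 : ℝ) < 2 ^ p := by positivity
  calc F y = 2 ^ p * (2 ^ (-p) * F y) := by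
        rw [← mul_assoc, ← Real.rpow_add (by norm_num)]; simp
    _ ≤ 2 ^ p * F (2 * y) := by gcongr

/-- The doubling estimate, iterated along the powers of two around `c`. -/
lemma le_two_rpow_mul_of_doubling {F : ℝ → ℝ} {p x₀ : ℝ} (hanti : Antitone F)
    (hpos : ∀ x, 0 < F x) (hp : 0 < p) (hx₀ : 0 < x₀)
    (hdoubling : ∀ y, x₀ ≤ y → F y ≤ 2 ^ p * F (2 * y)) {y c : ℝ} (hy : x₀ ≤ y) (hc : 1 ≤ c) :
    F y ≤ 2 ^ p * c ^ p * F (c * y) := by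
  have hypos : 0 < y := hx₀.trans_le hy
  have hiter : ∀ k : ℕ, F y ≤ ((2 : ℝ) ^ k) ^ p * F (2 ^ k * y) := by
    intro k
    induction k with
    | zero => simp
    | succ k ih =>
      have hk : (1 : ℝ) ≤ 2 ^ k := one_le_pow₀ (by norm_num)
      have := hdoubling (2 ^ k * y) (hy.trans (le_mul_of_one_le_left hypos.le hk))
      calc F y ≤ ((2 : ℝ) ^ k) ^ p * F (2 ^ k * y) := ih
        _ ≤ ((2 : ℝ) ^ k) ^ p * (2 ^ p * F (2 * (2 ^ k * y))) := by gcongr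
        _ = ((2 : ℝ) ^ (k + 1)) ^ p * F (2 ^ (k + 1) * y) := by
          rw [pow_succ, Real.mul_rpow (by positivity) (by norm_num), mul_assoc]
          congr 3; ring
  obtain ⟨k, hk1, hk2⟩ := exists_nat_pow_near hc (one_lt_two (α := ℝ))
  calc F y ≤ ((2 : ℝ) ^ (k + 1)) ^ p * F (2 ^ (k + 1) * y) := hiter (k + 1)
    _ ≤ (2 * c) ^ p * F (c * y) := by
      have h1 : (2 : ℝ) ^ (k + 1) ≤ 2 * c := by rw [pow_succ]; linarith
      have h2 : F (2 ^ (k + 1) * y) ≤ F (c * y) := hanti (by gcongr)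
      have h3 := (hpos (2 ^ (k + 1) * y)).le
      gcongr
    _ = 2 ^ p * c ^ p * F (c * y) := by
      rw [Real.mul_rpow (by norm_num) (by linarith)]

/-- A Potter-type bound: a bounded, nonincreasing, regularly varying function of index `-α` loses
at most a factor of order `1 + c ^ p`, `p > α`, under a dilation of its argument, uniformly in the
dilation constant `c`. -/
lemma RegularlyVarying.exists_forall_div_le {F : ℝ → ℝ} {α p : ℝ}
    (hF : RegularlyVarying F (-α)) (hanti : Antitone F) (hF_le : ∀ x, F x ≤ 1)
    (hα : 0 < α) (hp : α < p) :
    ∃ C x₀ : ℝ, 0 < C ∧ 0 < x₀ ∧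
      ∀ x, x₀ ≤ x → ∀ c, 0 < c → F (x / c) ≤ C * (1 + c ^ p) * F x := by
  have hpos := hF.pos_of_antitone hanti
  have hp0 : 0 < p := hα.trans hp
  obtain ⟨x₀, hx₀, hd⟩ := hF.exists_le_two_rpow_mul hp
  have h2p : (1 : ℝ) ≤ 2 ^ p := Real.one_le_rpow (by norm_num) hp0.le
  have hC : 2 ^ p ≤ 2 ^ p / F x₀ := le_div_self (by positivity) (hpos x₀) (hF_le x₀)
  refine ⟨2 ^ p / F x₀, x₀, div_pos (by positivity) (hpos x₀), hx₀, fun x hx c hc => ?_⟩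
  have hx' : 0 < x := hx₀.trans_le hx
  have hcp : 0 ≤ c ^ p := by positivity
  have hCpos : 0 ≤ 2 ^ p / F x₀ := by linarith
  rcases le_total c 1 with hc1 | hc1
  · calc F (x / c) ≤ F x := hanti (le_div_self hx'.le hc hc1)
      _ = 1 * 1 * F x := by ring
      _ ≤ 2 ^ p / F x₀ * (1 + c ^ p) * F x := by
        have := (hpos x).le
        gcongr <;> linarith
  suffices h : F (x / c) ≤ 2 ^ p / F x₀ * c ^ p * F x by
    refine h.trans ?_
    have := (hpos x).le
    gcongr
    linarith
  rcases le_total x₀ (x / c) with hxc | hxc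
  · calc F (x / c) ≤ 2 ^ p * c ^ p * F (c * (x / c)) :=
          le_two_rpow_mul_of_doubling hanti hpos hp0 hx₀ hd hxc hc1
      _ = 2 ^ p * c ^ p * F x := by rw [mul_div_cancel₀ _ hc.ne']
      _ ≤ 2 ^ p / F x₀ * c ^ p * F x := by
        have := (hpos x).le
        gcongr
  -- Below `x₀` there is no doubling estimate; there `F (x / c) ≤ 1` is compared with `F x₀`.
  · have h1 : F x₀ ≤ 2 ^ p * (x / x₀) ^ p * F (x / x₀ * x₀) :=
      le_two_rpow_mul_of_doubling hanti hpos hp0 hx₀ hd le_rfl ((one_le_div hx₀).2 hx)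
    rw [div_mul_cancel₀ _ hx₀.ne'] at h1
    have h2 : x / x₀ ≤ c := by
      rw [div_le_iff₀ hx₀]; rw [div_le_iff₀ hc] at hxc; linarith
    calc F (x / c) ≤ 1 := hF_le _
      _ = F x₀ / F x₀ := (div_self (hpos x₀).ne').symm
      _ ≤ (2 ^ p * c ^ p * F x) / F x₀ := by
        have := (hpos x).le
        have := (hpos x₀).le
        gcongr
        exact h1.trans (by gcongr)
      _ = 2 ^ p / F x₀ * c ^ p * F x := by ring

/-! ### Weighted sums with deterministic weights -/

section DeterministicWeights

variable {Ω : Type*} [MeasurableSpace Ω] {P : Measure Ω} {F : ℝ → ℝ} {α : ℝ}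

lemma tendsto_tail_mul_div {Z : Ω → ℝ} (hF : RegularlyVarying F (-α)) (hα : 0 < α)
    (hZ : ∀ x, P.real {ω | x < Z ω} = F x) {c : ℝ} (hc : 0 ≤ c) :
    Tendsto (fun x => P.real {ω | x < Z ω * c} / F x) atTop (𝓝 (c ^ α)) := by
  rcases hc.eq_or_lt with rfl | hc
  · rw [Real.zero_rpow hα.ne']
    refine tendsto_const_nhds.congr' ?_
    filter_upwards [eventually_ge_atTop 0] with x hx
    simp [not_lt.2 hx]
  · have h := hF.2 c⁻¹ (inv_pos.2 hc)
    rw [Real.rpow_neg (by positivity), Real.inv_rpow hc.le, inv_inv] at h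
    refine h.congr fun x => ?_
    rw [← hZ]
    congr 3
    ext ω
    rw [inv_mul_lt_iff₀ hc, mul_comm]

lemma tendsto_tail_inter_mul_div [IsFiniteMeasure P] {Z W : Ω → ℝ}
    (hF : RegularlyVarying F (-α))
    (hZW : Tendsto (fun x => P.real {ω | x < Z ω ∧ x < W ω} / F x) atTop (𝓝 0))
    {a b : ℝ} (ha : 0 ≤ a) (hb : 0 ≤ b) :
    Tendsto (fun x => P.real {ω | x < Z ω * a ∧ x < W ω * b} / F x) atTop (𝓝 0) := by
  -- The summand `1` keeps `c` positive when both weights vanish.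
  set c : ℝ := a + b + 1 with hc_def
  have hc : 0 < c := by positivity
  have hlim : Tendsto (fun x : ℝ => c⁻¹ * x) atTop atTop :=
    tendsto_id.const_mul_atTop (inv_pos.2 hc)
  have h := (hZW.comp hlim).mul (hF.2 c⁻¹ (inv_pos.2 hc))
  rw [zero_mul] at h
  refine tendsto_of_tendsto_of_tendsto_of_le_of_le' tendsto_const_nhds h ?_ ?_
  · filter_upwards [hF.1] with x hx
    positivity
  · filter_upwards [hF.1, hlim.eventually hF.1, eventually_gt_atTop 0] with x hx hx' hx0
    have key : ∀ z d : ℝ, 0 ≤ d → d ≤ c → x < z * d → c⁻¹ * x < z := by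
      intro z d hd hdc hz
      have hz0 : 0 < z := pos_of_mul_pos_left (hx0.trans hz) hd
      rw [inv_mul_lt_iff₀ hc, mul_comm]
      exact hz.trans_le (by gcongr)
    simp only [Function.comp_apply]
    rw [div_mul_div_cancel₀ hx'.ne']
    refine div_le_div_of_nonneg_right (measureReal_mono (fun ω hω => ?_)) hx.le
    exact ⟨key _ a ha (by linarith) hω.1, key _ b hb (by linarith) hω.2⟩

/-- Exceedances of asymptotically independent summands do not overlap asymptotically, so that the
probability of their union is asymptotic to the sum of their probabilities. -/
lemma tendsto_tail_biUnion_div [IsFiniteMeasure P] {X : ℕ → Ω → ℝ} (hX : ∀ i, Measurable (X i))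
    (hF : RegularlyVarying F (-α)) (hα : 0 < α) {θ : ℕ → ℝ} (hθ : ∀ i, 0 ≤ θ i) (s : Finset ℕ)
    (htail : ∀ i ∈ s, ∀ x, P.real {ω | x < X i ω} = F x)
    (hpair : ∀ i ∈ s, ∀ j ∈ s, i ≠ j →
      Tendsto (fun x => P.real {ω | x < X i ω ∧ x < X j ω} / F x) atTop (𝓝 0)) :
    Tendsto (fun x => P.real (⋃ i ∈ s, {ω | x < X i ω * θ i}) / F x) atTop
      (𝓝 (∑ i ∈ s, θ i ^ α)) := by
  have hmeas : ∀ i x, MeasurableSet {ω | x < X i ω * θ i} := fun i x =>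
    measurableSet_lt measurable_const ((hX i).mul_const _)
  induction s using Finset.induction_on with
  | empty => simp
  | insert a s ha ih =>
    have ih := ih (fun i hi => htail i (Finset.mem_insert_of_mem hi)) fun i hi j hj =>
      hpair i (Finset.mem_insert_of_mem hi) j (Finset.mem_insert_of_mem hj)
    have h1 := tendsto_tail_mul_div hF hα (htail a (Finset.mem_insert_self a s)) (hθ a)
    have h2 : Tendsto (fun x => P.real ({ω | x < X a ω * θ a} ∩
        ⋃ i ∈ s, {ω | x < X i ω * θ i}) / F x) atTop (𝓝 0) := by
      have hsum : Tendsto (fun x => ∑ j ∈ s,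
          P.real {ω | x < X a ω * θ a ∧ x < X j ω * θ j} / F x) atTop (𝓝 (∑ j ∈ s, (0 : ℝ))) := by
        refine tendsto_finsetSum _ fun j hj => ?_
        refine tendsto_tail_inter_mul_div hF ?_ (hθ a) (hθ j)
        exact hpair a (Finset.mem_insert_self a s) j (Finset.mem_insert_of_mem hj)
          (fun h => ha (h ▸ hj))
      rw [Finset.sum_const_zero] at hsum
      refine tendsto_of_tendsto_of_tendsto_of_le_of_le' tendsto_const_nhds hsum ?_ ?_
      · filter_upwards [hF.1] with x hx
        positivity
      · filter_upwards [hF.1] with x hx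
        rw [← Finset.sum_div]
        gcongr
        rw [Set.inter_iUnion₂]
        exact measureReal_biUnion_finset_le s _
    have h3 := (h1.add ih).sub h2
    rw [sub_zero] at h3
    rw [Finset.sum_insert ha]
    refine h3.congr fun x => ?_
    rw [← add_div, ← sub_div]
    congr 1
    rw [Finset.set_biUnion_insert]
    have := measureReal_union_add_inter (μ := P) (s := {ω | x < X a ω * θ a})
      (Finset.measurableSet_biUnion s fun i _ => hmeas i x) (measure_ne_top _ _)
      (measure_ne_top _ _)
    linarith

/-- If a sum exceeds `x`, then either one term nearly exceeds `x` on its own, or two terms are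
both at least of order `x`. -/
lemma exists_lt_or_exists_pair_of_lt_sum {ι : Type*} {s : Finset ι} {v : ι → ℝ} {x δ : ℝ}
    (hx : 0 < x) (hδ : 0 < δ) (hδ1 : δ < 1) {K : ℝ} (hK : 0 < K) (hsK : (s.card : ℝ) ≤ K)
    (hsum : x < ∑ i ∈ s, v i) :
    (∃ i ∈ s, (1 - δ) * x < v i) ∨
      ∃ i ∈ s, ∃ j ∈ s, i ≠ j ∧ δ * x / K < v i ∧ δ * x / K < v j := by
  classical
  by_contra! hcon
  obtain ⟨h1, h2⟩ := hcon
  have hq : 0 ≤ δ * x / K := by positivity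
  have hcard : (s.card : ℝ) * (δ * x / K) ≤ δ * x := by
    calc (s.card : ℝ) * (δ * x / K) ≤ K * (δ * x / K) := by gcongr
      _ = δ * x := by field_simp
  obtain ⟨i, hi, hvi⟩ : ∃ i ∈ s, δ * x / K < v i := by
    by_contra! h
    have := Finset.sum_le_card_nsmul s v _ h
    rw [nsmul_eq_mul] at this
    nlinarith
  have h3 : ∑ j ∈ s.erase i, v j ≤ (s.erase i).card • (δ * x / K) :=
    Finset.sum_le_card_nsmul _ _ _ fun j hj =>
      h2 i hi j (Finset.mem_of_mem_erase hj) (Finset.ne_of_mem_erase hj).symm hvi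
  have h4 : ((s.erase i).card : ℝ) ≤ s.card := by
    exact_mod_cast Finset.card_le_card (Finset.erase_subset i s)
  rw [nsmul_eq_mul] at h3
  have h5 := mul_le_mul_of_nonneg_right h4 hq
  have h6 := h1 i hi
  rw [← Finset.add_sum_erase s v hi] at hsum
  linarith

/-- The principle of a single big jump for finitely many asymptotically independent summands with
deterministic weights. -/
lemma tendsto_tail_sum_div [IsFiniteMeasure P] {X : ℕ → Ω → ℝ} (hX : ∀ i, Measurable (X i))
    (hX_nonneg : ∀ i, 0 ≤ᵐ[P] X i)
    (hF : RegularlyVarying F (-α)) (hα : 0 < α) {θ : ℕ → ℝ} (hθ : ∀ i, 0 ≤ θ i) (s : Finset ℕ)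
    (htail : ∀ i ∈ s, ∀ x, P.real {ω | x < X i ω} = F x)
    (hpair : ∀ i ∈ s, ∀ j ∈ s, i ≠ j →
      Tendsto (fun x => P.real {ω | x < X i ω ∧ x < X j ω} / F x) atTop (𝓝 0)) :
    Tendsto (fun x => P.real {ω | x < ∑ i ∈ s, X i ω * θ i} / F x) atTop
      (𝓝 (∑ i ∈ s, θ i ^ α)) := by
  refine tendsto_order.2 ⟨fun b hb => ?_, fun b hb => ?_⟩
  · have hU := tendsto_tail_biUnion_div hX hF hα hθ s htail hpair
    filter_upwards [hU.eventually (lt_mem_nhds hb), hF.1] with x hx hFx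
    refine hx.trans_le ?_
    refine div_le_div_of_nonneg_right ?_ hFx.le
    refine ENNReal.toReal_mono (measure_ne_top _ _) (measure_mono_ae ?_)
    filter_upwards [ae_all_iff.2 hX_nonneg] with ω hω hmem
    obtain ⟨i, hi, hlt⟩ := Set.mem_iUnion₂.1 hmem
    exact lt_of_lt_of_le hlt (Finset.single_le_sum (f := fun i => X i ω * θ i)
      (fun j _ => mul_nonneg (hω j) (hθ j)) hi)
  · -- The factor `1 - δ` lost in the single jump is absorbed by the room between the limit and `b`.
    have hcont : Tendsto (fun δ : ℝ => ∑ i ∈ s, (θ i / (1 - δ)) ^ α) (𝓝[>] 0)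
        (𝓝 (∑ i ∈ s, θ i ^ α)) := by
      have : ContinuousAt (fun δ : ℝ => ∑ i ∈ s, (θ i / (1 - δ)) ^ α) 0 := by
        refine tendsto_finsetSum _ fun i _ => ?_
        refine ContinuousAt.rpow_const ?_ (Or.inr hα.le)
        exact continuousAt_const.div (by fun_prop) (by norm_num)
      have h := this.tendsto.mono_left (nhdsWithin_le_nhds (s := Set.Ioi 0))
      simpa using h
    obtain ⟨δ, ⟨hδb, hδ0 : 0 < δ⟩, hδ1⟩ := (((hcont.eventually (gt_mem_nhds hb)).and
      self_mem_nhdsWithin).and (nhdsWithin_le_nhds (gt_mem_nhds one_pos))).exists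
    -- The summand `1` keeps `K` positive when `s` is empty.
    set K : ℝ := s.card + 1 with hK_def
    have hK : 0 < K := by positivity
    have h1δ : 0 < 1 - δ := by linarith
    have hA : Tendsto (fun x => ∑ i ∈ s, P.real {ω | x < X i ω * (θ i / (1 - δ))} / F x) atTop
        (𝓝 (∑ i ∈ s, (θ i / (1 - δ)) ^ α)) :=
      tendsto_finsetSum _ fun i hi =>
        tendsto_tail_mul_div hF hα (htail i hi) (div_nonneg (hθ i) h1δ.le)
    have hB : Tendsto (fun x => ∑ i ∈ s, ∑ j ∈ s.erase i,
        P.real {ω | x < X i ω * (θ i * K / δ) ∧ x < X j ω * (θ j * K / δ)} / F x) atTop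
        (𝓝 (∑ i ∈ s, ∑ j ∈ s.erase i, (0 : ℝ))) := by
      refine tendsto_finsetSum _ fun i hi => tendsto_finsetSum _ fun j hj => ?_
      have hi' := hθ i
      have hj' := hθ j
      exact tendsto_tail_inter_mul_div hF (hpair i hi j (Finset.mem_of_mem_erase hj)
        (Finset.ne_of_mem_erase hj).symm) (by positivity) (by positivity)
    have hAB := hA.add hB
    simp only [Finset.sum_const_zero, add_zero] at hAB
    filter_upwards [hAB.eventually (gt_mem_nhds hδb), hF.1, eventually_gt_atTop 0]
      with x hx hFx hx0
    refine lt_of_le_of_lt ?_ hx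
    simp only [← Finset.sum_div]
    rw [← add_div]
    gcongr
    have hsub : {ω | x < ∑ i ∈ s, X i ω * θ i} ⊆
        (⋃ i ∈ s, {ω | x < X i ω * (θ i / (1 - δ))}) ∪ ⋃ i ∈ s, ⋃ j ∈ s.erase i,
          {ω | x < X i ω * (θ i * K / δ) ∧ x < X j ω * (θ j * K / δ)} := by
      intro ω hω
      rcases exists_lt_or_exists_pair_of_lt_sum hx0 hδ0 hδ1 hK (by simp [hK_def]) hω with
        ⟨i, hi, h⟩ | ⟨i, hi, j, hj, hij, h, h'⟩
      · refine Or.inl (Set.mem_biUnion hi ?_)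
        rw [Set.mem_ofPred_eq, ← mul_div_assoc, lt_div_iff₀ h1δ]
        linarith
      · refine Or.inr (Set.mem_biUnion hi (Set.mem_biUnion
          (Finset.mem_erase.2 ⟨hij.symm, hj⟩) ⟨?_, ?_⟩))
        all_goals
          rw [div_lt_iff₀ hK] at h h'
          rw [← mul_div_assoc, lt_div_iff₀ hδ0]
          linarith
    refine (measureReal_mono hsub (measure_ne_top _ _)).trans ((measureReal_union_le _ _).trans ?_)
    gcongr
    · exact measureReal_biUnion_finset_le s _
    · refine (measureReal_biUnion_finset_le s _).trans ?_
      gcongr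
      exact measureReal_biUnion_finset_le _ _

/-- The union bound `P(∑ X_i θ_i > x) ≤ ∑ P(X_i θ_i > x / n)`, combined with a bound on dilated
tails. -/
lemma tail_sum_le [IsFiniteMeasure P] {X : ℕ → Ω → ℝ} {θ : ℕ → ℝ} (hθ : ∀ i, 0 ≤ θ i)
    {s : Finset ℕ} (htail : ∀ i ∈ s, ∀ x, P.real {ω | x < X i ω} = F x) {C p x : ℝ}
    (hx : 0 < x) (hC : 0 ≤ C) (hFx : 0 ≤ F x)
    (hbound : ∀ c, 0 < c → F (x / c) ≤ C * (1 + c ^ p) * F x) :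
    P.real {ω | x < ∑ i ∈ s, X i ω * θ i} ≤
      (∑ i ∈ s, C * (1 + (s.card * θ i) ^ p)) * F x := by
  have hsub : {ω | x < ∑ i ∈ s, X i ω * θ i} ⊆ ⋃ i ∈ s, {ω | x < X i ω * (s.card * θ i)} := by
    intro ω hω
    by_contra hcon
    simp only [Set.mem_iUnion, Set.mem_ofPred_eq, not_exists, not_lt] at hcon
    rcases s.eq_empty_or_nonempty with rfl | hs
    · simp at hω
      linarith
    have hcard : (0 : ℝ) < s.card := by exact_mod_cast hs.card_pos
    have h := Finset.sum_le_card_nsmul s (fun i => X i ω * θ i) (x / s.card) fun i hi => by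
      rw [le_div_iff₀ hcard]
      linarith [hcon i hi]
    rw [nsmul_eq_mul, mul_div_cancel₀ _ hcard.ne'] at h
    exact absurd hω (not_lt.2 h)
  refine (measureReal_mono hsub (measure_ne_top _ _)).trans
    ((measureReal_biUnion_finset_le s _).trans ?_)
  rw [Finset.sum_mul]
  refine Finset.sum_le_sum fun i hi => ?_
  rcases (mul_nonneg (Nat.cast_nonneg s.card) (hθ i) : (0 : ℝ) ≤ s.card * θ i).eq_or_lt with h | h
  · rw [← h]
    simp only [mul_zero, not_lt.2 hx.le, Set.ofPred_false, measureReal_empty]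
    positivity
  · refine le_trans (le_of_eq ?_) (hbound _ h)
    rw [← htail i hi]
    congr 1
    ext ω
    rw [Set.mem_ofPred_eq, Set.mem_ofPred_eq, div_lt_iff₀ h]

end DeterministicWeights

/-! ### Arrival times as functionals of the path -/

/-- The `i`-th arrival time as a functional of the path `n` of a counting process. The infimum runs
over a countable dense set of times, which makes the functional measurable for the product
`σ`-algebra on paths; on nondecreasing paths this does not change its value. -/
def pathArrivalTime (i : ℕ) (n : ℝ≥0 → ℕ) : ℝ :=
  (⨅ k : ℕ, if i ≤ n (TopologicalSpace.denseSeq ℝ≥0 k) then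
    ((TopologicalSpace.denseSeq ℝ≥0 k : ℝ≥0) : ℝ≥0∞) else ⊤).toReal

lemma measurable_pathArrivalTime (i : ℕ) : Measurable (pathArrivalTime i) := by
  refine (Measurable.iInf fun k =>
    Measurable.ite ?_ measurable_const measurable_const).ennreal_toReal
  exact measurableSet_le measurable_const (measurable_pi_apply _)

lemma pathArrivalTime_nonneg (i : ℕ) (n : ℝ≥0 → ℕ) : 0 ≤ pathArrivalTime i n :=
  ENNReal.toReal_nonneg

lemma pathArrivalTime_eq_sInf {i : ℕ} {n : ℝ≥0 → ℕ} (hn : Monotone n) (h : ∃ t, i ≤ n t) :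
    pathArrivalTime i n = (sInf {t | i ≤ n t} : ℝ≥0) := by
  have hbdd : BddBelow {t : ℝ≥0 | i ≤ n t} := OrderBot.bddBelow _
  have key : (⨅ k : ℕ, if i ≤ n (TopologicalSpace.denseSeq ℝ≥0 k) then
      ((TopologicalSpace.denseSeq ℝ≥0 k : ℝ≥0) : ℝ≥0∞) else ⊤) =
      ((sInf {t | i ≤ n t} : ℝ≥0) : ℝ≥0∞) := by
    refine le_antisymm (ENNReal.le_of_forall_pos_le_add fun ε hε _ => ?_) (le_iInf fun k => ?_)
    · obtain ⟨t, ht, hlt⟩ := exists_lt_of_csInf_lt (s := {t : ℝ≥0 | i ≤ n t}) h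
        (lt_add_of_pos_right (sInf {t : ℝ≥0 | i ≤ n t}) hε)
      obtain ⟨k, hk⟩ := (TopologicalSpace.denseRange_denseSeq ℝ≥0).exists_mem_open
        isOpen_Ioo (Set.nonempty_Ioo.2 hlt)
      refine (iInf_le _ k).trans ?_
      rw [if_pos (le_trans ht (hn hk.1.le))]
      exact_mod_cast hk.2.le
    · split_ifs with hk
      · exact_mod_cast csInf_le hbdd hk
      · exact le_top
  rw [pathArrivalTime, key]
  rfl

/-- Right continuity makes the infimum attained, so an arrival by time `t` is the same as a count of
at least `i` at time `t`. -/
lemma sInf_le_iff_of_rightContinuous {i : ℕ} {n : ℝ≥0 → ℕ} (hn : Monotone n)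
    (hr : ∀ t, ContinuousWithinAt n (Set.Ici t) t) (h : ∃ t, i ≤ n t) (t : ℝ≥0) :
    sInf {t | i ≤ n t} ≤ t ↔ i ≤ n t := by
  refine ⟨fun hle => le_trans ?_ (hn hle), fun ht => csInf_le (OrderBot.bddBelow _) ht⟩
  set a := sInf {t | i ≤ n t} with ha
  have hev : ∀ᶠ s in 𝓝[≥] a, n s = n a :=
    (hr a).eventually (p := fun m => m = n a) (by simp)
  obtain ⟨b, hab, hb⟩ := mem_nhdsGE_iff_exists_Ico_subset.1 hev
  obtain ⟨s, hs, hsb⟩ := exists_lt_of_csInf_lt (s := {t : ℝ≥0 | i ≤ n t}) h hab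
  have : n s = n a := hb ⟨csInf_le (OrderBot.bddBelow _) hs, hsb⟩
  exact this ▸ hs

/-! ### Poisson weights and the law of the shock times -/

/-- The mean of the first of two independent Poisson variables with means `a` and `b`, on the event
that their sum is `n`, multiplied by `a + b` to avoid a division. -/
lemma sum_mul_poisson_mul_poisson (a b : ℝ) (n : ℕ) :
    (∑ k ∈ Finset.range (n + 1), (k : ℝ) * ((Real.exp (-a) * a ^ k / k.factorial) *
      (Real.exp (-b) * b ^ (n - k) / (n - k).factorial))) * (a + b) =
      n * (Real.exp (-(a + b)) * (a + b) ^ n / n.factorial) * a := by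
  cases n with
  | zero => simp
  | succ n =>
    have h : ∑ k ∈ Finset.range (n + 1), a ^ k / k.factorial * (b ^ (n - k) / (n - k).factorial) =
        (a + b) ^ n / n.factorial := by
      rw [add_pow, Finset.sum_div]
      refine Finset.sum_congr rfl fun k hk => ?_
      rw [Nat.cast_choose ℝ (Nat.lt_succ_iff.1 (Finset.mem_range.1 hk))]
      have := Nat.cast_ne_zero (R := ℝ).2 n.factorial_ne_zero
      field_simp
    rw [Finset.sum_range_succ']
    simp only [Nat.cast_zero, zero_mul, add_zero, Nat.add_sub_add_right]
    have hterm : ∀ k ∈ Finset.range (n + 1), ((k + 1 : ℕ) : ℝ) *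
        ((Real.exp (-a) * a ^ (k + 1) / (k + 1).factorial) *
          (Real.exp (-b) * b ^ (n - k) / (n - k).factorial)) =
        Real.exp (-a) * Real.exp (-b) * a *
          (a ^ k / k.factorial * (b ^ (n - k) / (n - k).factorial)) := by
      intro k _
      rw [Nat.factorial_succ]
      push_cast
      have : (k : ℝ) + 1 ≠ 0 := by positivity
      field_simp
      ring
    rw [Finset.sum_congr rfl hterm, ← Finset.mul_sum, h, neg_add, Real.exp_add,
      Nat.factorial_succ]
    push_cast
    have : (n : ℝ) + 1 ≠ 0 := by positivity
    field_simp
    ring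

lemma summable_poisson_mul_pow (r : ℝ≥0) (k : ℕ) :
    Summable fun n : ℕ => Real.exp (-r) * r ^ n / n.factorial * (n : ℝ) ^ k := by
  have h : Summable fun n : ℕ => k.factorial * Real.exp (-r) *
      (((r : ℝ) * Real.exp 1) ^ n / n.factorial) :=
    (Real.summable_pow_div_factorial _).mul_left _
  refine Summable.of_nonneg_of_le (fun n => by positivity) (fun n => ?_) h
  have h1 : (n : ℝ) ^ k ≤ k.factorial * Real.exp 1 ^ n := by
    have := Real.pow_div_factorial_le_exp (n : ℝ) (Nat.cast_nonneg n) k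
    rw [div_le_iff₀ (by positivity)] at this
    rw [← Real.exp_nat_mul, mul_one, mul_comm]
    exact this
  calc Real.exp (-r) * r ^ n / n.factorial * (n : ℝ) ^ k
      ≤ Real.exp (-r) * r ^ n / n.factorial * (k.factorial * Real.exp 1 ^ n) := by gcongr
    _ = _ := by rw [mul_pow]; ring

lemma hasSum_poisson_mul_natCast (r : ℝ≥0) :
    HasSum (fun n : ℕ => Real.exp (-r) * r ^ n / n.factorial * (n : ℝ)) r := by
  have h := (hasSum_one_poissonMeasure r).mul_left (r : ℝ)
  rw [mul_one] at h
  rw [← hasSum_nat_add_iff' 1]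
  simp only [Finset.range_one, Finset.sum_singleton, Nat.cast_zero, mul_zero, sub_zero]
  refine h.congr_fun fun n => ?_
  rw [Nat.factorial_succ]
  push_cast
  have : (n : ℝ) + 1 ≠ 0 := by positivity
  field_simp
  ring

lemma lintegral_poissonMeasure_ofReal (r : ℝ≥0) {f : ℕ → ℝ} (hf : ∀ n, 0 ≤ f n)
    (hs : Summable fun n : ℕ => Real.exp (-r) * r ^ n / n.factorial * f n) :
    ∫⁻ n, ENNReal.ofReal (f n) ∂(poissonMeasure r) =
      ENNReal.ofReal (∑' n : ℕ, Real.exp (-r) * r ^ n / n.factorial * f n) := by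
  rw [lintegral_countable', ENNReal.ofReal_tsum_of_nonneg
    (fun n => mul_nonneg (by positivity) (hf n)) hs]
  refine tsum_congr fun n => ?_
  rw [poissonMeasure_singleton, ← ENNReal.ofReal_mul (hf n), mul_comm]

section Intensity

variable {lam : ℝ → ℝ}

lemma cumulativeIntensity_zero (lam : ℝ → ℝ) : cumulativeIntensity lam 0 = 0 := by
  simp [cumulativeIntensity]

lemma IsIntensity.cumulativeIntensity_mono (hlam : IsIntensity lam) {s t : ℝ} (hs : 0 ≤ s)
    (hst : s ≤ t) : cumulativeIntensity lam s ≤ cumulativeIntensity lam t := by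
  refine intervalIntegral.integral_mono_interval le_rfl hs hst ?_
    (hlam.intervalIntegrable t (hs.trans hst))
  filter_upwards [ae_restrict_mem measurableSet_Ioc] with u hu using hlam.nonneg u hu.1.le

lemma IsIntensity.cumulativeIntensity_nonneg (hlam : IsIntensity lam) {t : ℝ} (ht : 0 ≤ t) :
    0 ≤ cumulativeIntensity lam t := by
  simpa [cumulativeIntensity_zero] using hlam.cumulativeIntensity_mono le_rfl ht

lemma shockTimeLaw_Iic (hlam : IsIntensity lam) {T : ℝ} (hT : 0 < cumulativeIntensity lam T)
    {a : ℝ} (ha : 0 ≤ a) (haT : a ≤ T) :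
    shockTimeLaw lam T (Set.Iic a) =
      ENNReal.ofReal (cumulativeIntensity lam a / cumulativeIntensity lam T) := by
  have hset : Set.Iic a ∩ Set.Icc 0 T = Set.Icc 0 a := by
    ext u
    simp only [Set.mem_inter_iff, Set.mem_Iic, Set.mem_Icc]
    exact ⟨fun h => ⟨h.2.1, h.1⟩, fun h => ⟨h.2, h.1, h.2.trans haT⟩⟩
  rw [shockTimeLaw, withDensity_apply _ measurableSet_Iic,
    Measure.restrict_restrict measurableSet_Iic, hset, ← ofReal_integral_eq_lintegral_ofReal,
    integral_div, integral_Icc_eq_integral_Ioc, ← intervalIntegral.integral_of_le ha]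
  · rfl
  · refine Integrable.div_const ?_ _
    exact (integrableOn_Icc_iff_integrableOn_Ioc (by simp)).2
      ((intervalIntegrable_iff_integrableOn_Ioc_of_le ha).1 (hlam.intervalIntegrable a ha))
  · filter_upwards [ae_restrict_mem measurableSet_Icc] with u hu
    exact div_nonneg (hlam.nonneg u hu.1) hT.le

/-- The distribution function of the shock times is constant beyond `T`. -/
lemma shockTimeLaw_Iic_min (hlam : IsIntensity lam) {T : ℝ} (hT0 : 0 ≤ T)
    (hT : 0 < cumulativeIntensity lam T) {a : ℝ} (ha : 0 ≤ a) :
    shockTimeLaw lam T (Set.Iic a) =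
      ENNReal.ofReal (cumulativeIntensity lam (min a T) / cumulativeIntensity lam T) := by
  rw [← shockTimeLaw_Iic hlam hT (le_min ha hT0) (min_le_right a T)]
  have hset : Set.Iic a ∩ Set.Icc 0 T = Set.Iic (min a T) ∩ Set.Icc 0 T := by
    ext u
    simp only [Set.mem_inter_iff, Set.mem_Iic, Set.mem_Icc, le_min_iff]
    tauto
  rw [shockTimeLaw, withDensity_apply _ measurableSet_Iic, withDensity_apply _ measurableSet_Iic,
    Measure.restrict_restrict measurableSet_Iic, Measure.restrict_restrict measurableSet_Iic, hset]

lemma shockTimeLaw_Iic_of_neg {T a : ℝ} (ha : a < 0) : shockTimeLaw lam T (Set.Iic a) = 0 := by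
  have hset : Set.Iic a ∩ Set.Icc 0 T = ∅ := by
    ext u
    simp only [Set.mem_inter_iff, Set.mem_Iic, Set.mem_Icc, Set.mem_empty_iff_false, iff_false]
    intro h
    linarith [h.1, h.2.1]
  rw [shockTimeLaw, withDensity_apply _ measurableSet_Iic,
    Measure.restrict_restrict measurableSet_Iic, hset]
  simp

lemma isProbabilityMeasure_shockTimeLaw (hlam : IsIntensity lam) {T : ℝ} (hT0 : 0 ≤ T)
    (hT : 0 < cumulativeIntensity lam T) : IsProbabilityMeasure (shockTimeLaw lam T) := by
  refine ⟨?_⟩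
  have h := shockTimeLaw_Iic hlam hT hT0 le_rfl
  rw [div_self hT.ne', ENNReal.ofReal_one] at h
  rw [← h, shockTimeLaw, withDensity_apply _ measurableSet_Iic, withDensity_apply _ .univ,
    Measure.restrict_restrict measurableSet_Iic, Measure.restrict_restrict .univ, Set.univ_inter,
    Set.inter_eq_self_of_subset_right Set.Icc_subset_Iic_self]

end Intensity

/-! ### Arrival times given the number of arrivals -/

section Arrivals

variable {Ω : Type*} [MeasurableSpace Ω] {P : Measure Ω} {N : ℝ≥0 → Ω → ℕ} {lam : ℝ → ℝ}

lemma IsInhomogeneousPoissonProcess.hasLaw (hN : IsInhomogeneousPoissonProcess N lam P)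
    (t : ℝ≥0) : HasLaw (N t) (poissonMeasure (cumulativeIntensity lam t).toNNReal) P := by
  have h := hN.law 0 t zero_le
  rw [NNReal.coe_zero, cumulativeIntensity_zero, sub_zero] at h
  refine h.congr ?_
  filter_upwards [hN.zero] with ω hω
  simp [hω]

lemma IsInhomogeneousPoissonProcess.measureReal_eq (hN : IsInhomogeneousPoissonProcess N lam P)
    (t : ℝ≥0) (n : ℕ) :
    P.real {ω | N t ω = n} = Real.exp (-cumulativeIntensity lam t) *
      cumulativeIntensity lam t ^ n / n.factorial := by
  have h := (hN.hasLaw t).measureReal_eq (p := fun k => k = n) (MeasurableSet.of_discrete)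
  rw [h, Set.ofPred_eq_eq_singleton, poissonMeasure_real_singleton,
    Real.coe_toNNReal _ (hN.isIntensity.cumulativeIntensity_nonneg t.coe_nonneg)]

lemma IsInhomogeneousPoissonProcess.measureReal_and (hN : IsInhomogeneousPoissonProcess N lam P)
    {t T : ℝ≥0} (htT : t ≤ T) {k n : ℕ} (hkn : k ≤ n) :
    P.real {ω | N t ω = k ∧ N T ω = n} =
      (Real.exp (-cumulativeIntensity lam t) * cumulativeIntensity lam t ^ k / k.factorial) *
      (Real.exp (-(cumulativeIntensity lam T - cumulativeIntensity lam t)) *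
        (cumulativeIntensity lam T - cumulativeIntensity lam t) ^ (n - k) /
          (n - k).factorial) := by
  have hind : IndepFun (N t) (N T - N t) P := by
    refine (hN.indepIncrements.indepFun_sub_sub zero_le htT).congr ?_ .rfl
    filter_upwards [hN.zero] with ω hω
    simp [hω]
  have hset : P.real {ω | N t ω = k ∧ N T ω = n} =
      P.real (N t ⁻¹' {k} ∩ (N T - N t) ⁻¹' {n - k}) := by
    refine measureReal_congr ?_
    filter_upwards [hN.monotone] with ω hω
    have hle : N t ω ≤ N T ω := hω htT
    refine propext ?_
    change (N t ω = k ∧ N T ω = n) ↔ (N t ω = k ∧ N T ω - N t ω = n - k)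
    omega
  have hlaw := (hN.law t T htT).measureReal_eq (p := fun j => j = n - k)
    (MeasurableSet.of_discrete)
  rw [Set.ofPred_eq_eq_singleton, poissonMeasure_real_singleton, Real.coe_toNNReal _
    (sub_nonneg.2 (hN.isIntensity.cumulativeIntensity_mono t.coe_nonneg
      (NNReal.coe_le_coe.2 htT)))] at hlaw
  rw [hset, measureReal_def, hind.measure_inter_preimage_eq_mul _ _ .of_discrete .of_discrete,
    ENNReal.toReal_mul, ← hlaw, ← hN.measureReal_eq t k]
  rfl

/-- The expected number of arrivals up to time `t` on the event `N T = n`, written as a sum over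
the arrivals. The summation is the binomial theorem in disguise: given `N T = n`, each arrival
falls into `[0, t]` with probability `m(t) / m(T)`. -/
lemma IsInhomogeneousPoissonProcess.sum_measureReal_le_and [IsFiniteMeasure P]
    (hN : IsInhomogeneousPoissonProcess N lam P) {t T : ℝ≥0} (htT : t ≤ T)
    (hT : 0 < cumulativeIntensity lam T) (n : ℕ) :
    ∑ i ∈ Finset.Icc 1 n, P.real {ω | i ≤ N t ω ∧ N T ω = n} =
      n * P.real {ω | N T ω = n} *
        (cumulativeIntensity lam t / cumulativeIntensity lam T) := by
  have hmeas : ∀ k, MeasurableSet {ω | N t ω = k ∧ N T ω = n} := fun k =>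
    (hN.measurable t (measurableSet_singleton k)).inter
      (hN.measurable T (measurableSet_singleton n))
  have hi : ∀ i, P.real {ω | i ≤ N t ω ∧ N T ω = n} = ∑ k ∈ Finset.range (n + 1),
      if i ≤ k then P.real {ω | N t ω = k ∧ N T ω = n} else 0 := by
    intro i
    rw [← Finset.sum_filter, ← measureReal_biUnion_finset]
    · refine measureReal_congr ?_
      filter_upwards [hN.monotone] with ω hω
      have hle : N t ω ≤ N T ω := hω htT
      refine propext ?_
      change (i ≤ N t ω ∧ N T ω = n) ↔ ω ∈ ⋃ k ∈ _, _
      simp only [Finset.mem_filter, Finset.mem_range, Set.mem_iUnion, Set.mem_ofPred_eq,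
        exists_prop]
      constructor
      · intro h
        exact ⟨N t ω, ⟨by omega, h.1⟩, rfl, h.2⟩
      · rintro ⟨k, ⟨_, h1⟩, h2, h3⟩
        exact ⟨by omega, h3⟩
    · intro k _ l _ hkl
      refine Set.disjoint_left.2 fun ω hω hω' => hkl ?_
      exact hω.1.symm.trans hω'.1
    · exact fun k _ => hmeas k
  simp_rw [hi]
  rw [Finset.sum_comm]
  have hk : ∀ k ∈ Finset.range (n + 1), (∑ i ∈ Finset.Icc 1 n,
      if i ≤ k then P.real {ω | N t ω = k ∧ N T ω = n} else 0) =
      k * P.real {ω | N t ω = k ∧ N T ω = n} := by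
    intro k hk
    have hfilter : (Finset.Icc 1 n).filter (fun i => i ≤ k) = Finset.Icc 1 k := by
      ext i
      simp only [Finset.mem_filter, Finset.mem_Icc, Finset.mem_range] at hk ⊢
      omega
    rw [← Finset.sum_filter, hfilter, Finset.sum_const, Nat.card_Icc, nsmul_eq_mul,
      Nat.add_sub_cancel]
  rw [Finset.sum_congr rfl hk, Finset.sum_congr rfl fun k hk => by
    rw [hN.measureReal_and htT (Nat.lt_succ_iff.1 (Finset.mem_range.1 hk))]]
  have h := sum_mul_poisson_mul_poisson (cumulativeIntensity lam t)
    (cumulativeIntensity lam T - cumulativeIntensity lam t) n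
  rw [add_sub_cancel, ← hN.measureReal_eq T n] at h
  rw [← mul_div_assoc, eq_div_iff hT.ne', h]

/-- On the event `N T = n`, the point process of arrivals up to `T` has intensity measure
`n` times the law of the shock times, as if the arrivals were `n` independent draws. -/
lemma IsInhomogeneousPoissonProcess.sum_map_pathArrivalTime [IsFiniteMeasure P]
    (hN : IsInhomogeneousPoissonProcess N lam P) {T : ℝ≥0}
    (hT : 0 < cumulativeIntensity lam T) (n : ℕ) :
    ∑ i ∈ Finset.Icc 1 n, (P.restrict {ω | N T ω = n}).map
        (fun ω => pathArrivalTime i (fun t => N t ω)) =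
      ((n : ℝ≥0∞) * P {ω | N T ω = n}) • shockTimeLaw lam T := by
  have hmeas : ∀ i, Measurable fun ω => pathArrivalTime i (fun t => N t ω) := fun i =>
    (measurable_pathArrivalTime i).comp (measurable_pi_lambda _ hN.measurable)
  refine Measure.ext_of_Iic _ _ fun a => ?_
  simp only [Measure.finsetSum_apply, Measure.smul_apply, smul_eq_mul,
    Measure.map_apply (hmeas _) measurableSet_Iic]
  rcases lt_or_ge a 0 with ha | ha
  · rw [shockTimeLaw_Iic_of_neg ha, mul_zero]
    refine Finset.sum_eq_zero fun i _ => ?_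
    have : (fun ω => pathArrivalTime i (fun t => N t ω)) ⁻¹' Set.Iic a = ∅ := by
      ext ω
      simp only [Set.mem_preimage, Set.mem_Iic, Set.mem_empty_iff_false, iff_false, not_le]
      exact ha.trans_le (pathArrivalTime_nonneg _ _)
    rw [this, measure_empty]
  -- As `i ≤ n = N T`, the arrival times in question are at most `T`, so `a` may exceed `T`.
  lift a to ℝ≥0 using ha
  have hterm : ∀ i ∈ Finset.Icc 1 n, (P.restrict {ω | N T ω = n})
      ((fun ω => pathArrivalTime i (fun t => N t ω)) ⁻¹' Set.Iic (a : ℝ)) =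
      ENNReal.ofReal (P.real {ω | i ≤ N (min a T) ω ∧ N T ω = n}) := by
    intro i hi
    rw [ofReal_measureReal, Measure.restrict_apply (hmeas i measurableSet_Iic)]
    refine measure_congr ?_
    filter_upwards [hN.monotone, hN.rightContinuous] with ω hmono hright
    refine propext ?_
    change (pathArrivalTime i (fun t => N t ω) ≤ a ∧ N T ω = n) ↔
      (i ≤ N (min a T) ω ∧ N T ω = n)
    refine and_congr_left fun hn => ?_
    have hex : i ≤ N T ω := hn ▸ (Finset.mem_Icc.1 hi).2
    rw [pathArrivalTime_eq_sInf hmono ⟨T, hex⟩, NNReal.coe_le_coe,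
      sInf_le_iff_of_rightContinuous hmono hright ⟨T, hex⟩]
    refine ⟨fun h => ?_, fun h => h.trans (hmono (min_le_left a T))⟩
    rcases min_choice a T with hm | hm <;> rw [hm] <;> assumption
  rw [Finset.sum_congr rfl hterm, ← ENNReal.ofReal_sum_of_nonneg fun i _ => measureReal_nonneg,
    hN.sum_measureReal_le_and (min_le_right a T) hT n,
    shockTimeLaw_Iic_min hN.isIntensity T.coe_nonneg hT a.coe_nonneg,
    ENNReal.ofReal_mul (by positivity),
    ENNReal.ofReal_mul (by positivity), ofReal_measureReal, ENNReal.ofReal_natCast,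
    NNReal.coe_min]

lemma IsInhomogeneousPoissonProcess.lintegral_natCast
    (hN : IsInhomogeneousPoissonProcess N lam P) (T : ℝ≥0) :
    ∫⁻ ω, (N T ω : ℝ≥0∞) ∂P = ENNReal.ofReal (cumulativeIntensity lam T) := by
  rw [(hN.hasLaw T).lintegral_comp (f := fun n : ℕ => (n : ℝ≥0∞)) (by fun_prop)]
  have h := hasSum_poisson_mul_natCast (cumulativeIntensity lam T).toNNReal
  have h' := lintegral_poissonMeasure_ofReal _ (fun n => Nat.cast_nonneg n) h.summable
  rw [h.tsum_eq, ENNReal.ofReal_coe_nnreal] at h'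
  simpa [ENNReal.ofReal] using h'

lemma IsInhomogeneousPoissonProcess.lintegral_pow_lt_top
    (hN : IsInhomogeneousPoissonProcess N lam P) (T : ℝ≥0) (k : ℕ) :
    ∫⁻ ω, (N T ω : ℝ≥0∞) ^ k ∂P < ∞ := by
  rw [(hN.hasLaw T).lintegral_comp (f := fun n : ℕ => (n : ℝ≥0∞) ^ k) (by fun_prop)]
  have h' := lintegral_poissonMeasure_ofReal _ (fun n => by positivity)
    (summable_poisson_mul_pow (cumulativeIntensity lam T).toNNReal k)
  simp_rw [ENNReal.ofReal_pow (Nat.cast_nonneg _), ENNReal.ofReal_natCast] at h'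
  rw [h']
  exact ENNReal.ofReal_lt_top

end Arrivals

/-! ### Sums over the arrivals -/

section Campbell

variable {Ω E : Type*} [MeasurableSpace Ω] [MeasurableSpace E] {P : Measure Ω}

lemma measurable_sum_Icc {β : Type*} [AddCommMonoid β] [MeasurableSpace β] [MeasurableAdd₂ β]
    {Z : Ω → ℕ} (hZ : Measurable Z) {f : ℕ → Ω → β} (hf : ∀ i, Measurable (f i)) :
    Measurable fun ω => ∑ i ∈ Finset.Icc 1 (Z ω), f i ω := by
  have h : Measurable fun q : ℕ × Ω => ∑ i ∈ Finset.Icc 1 q.1, f i q.2 :=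
    measurable_from_prod_countable_right fun n =>
      Finset.measurable_fun_sum (Finset.Icc 1 n) fun i _ => hf i
  exact h.comp (hZ.prodMk measurable_id)

/-- Of two independent random elements, one may be frozen while integrating over the other. -/
lemma lintegral_comp_eq_lintegral_lintegral [IsFiniteMeasure P] {A B : Type*} [MeasurableSpace A]
    [MeasurableSpace B] {U : Ω → A} {W : Ω → B} (hU : Measurable U) (hW : Measurable W)
    (hUW : IndepFun U W P) {f : A × B → ℝ≥0∞} (hf : Measurable f) :
    ∫⁻ ω, f (U ω, W ω) ∂P = ∫⁻ ω', ∫⁻ ω, f (U ω, W ω') ∂P ∂P := by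
  rw [← lintegral_map hf (hU.prodMk hW),
    (indepFun_iff_map_prod_eq_prod_map_map hU.aemeasurable hW.aemeasurable).1 hUW,
    lintegral_prod_symm _ hf.aemeasurable, lintegral_map hf.lintegral_prod_left' hW]
  refine lintegral_congr fun ω' => ?_
  exact lintegral_map (hf.comp measurable_prodMk_right) hU

lemma lintegral_eq_tsum_setLIntegral_fiber {Z : Ω → ℕ} (hZ : Measurable Z) (g : Ω → ℝ≥0∞) :
    ∫⁻ ω, g ω ∂P = ∑' n, ∫⁻ ω in {ω | Z ω = n}, g ω ∂P := by
  rw [← lintegral_iUnion (s := fun n => {ω | Z ω = n})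
    (fun n => hZ (measurableSet_singleton n))]
  · have : ⋃ n, {ω | Z ω = n} = Set.univ := by
      ext ω
      simp
    rw [this, setLIntegral_univ]
  · intro m n hmn
    exact Set.disjoint_left.2 fun ω hω hω' => hmn (Eq.trans (Eq.symm hω) hω')

variable {N : ℝ≥0 → Ω → ℕ} {lam : ℝ → ℝ}

/-- Campbell's formula for the arrivals up to `T`, marked by the identically distributed `ξ i` and
weighted by a function of the total number of arrivals. -/
lemma IsInhomogeneousPoissonProcess.lintegral_sum_arrivals [IsProbabilityMeasure P]
    (hN : IsInhomogeneousPoissonProcess N lam P) {T : ℝ≥0} (hT : 0 < cumulativeIntensity lam T)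
    {ξ : ℕ → Ω → E} (hξ : ∀ i, Measurable (ξ i)) (hξ_ident : ∀ i, IdentDistrib (ξ i) (ξ 0) P P)
    (hξN : IndepFun (fun ω i => ξ i ω) (fun ω t => N t ω) P)
    {φ : E × ℝ → ℝ≥0∞} (hφ : Measurable φ) (w : ℕ → ℝ≥0∞) :
    ∫⁻ ω, w (N T ω) * ∑ i ∈ Finset.Icc 1 (N T ω),
        φ (ξ i ω, pathArrivalTime i (fun t => N t ω)) ∂P =
      (∫⁻ ω, w (N T ω) * N T ω ∂P) *
        ∫⁻ z : Ω × ℝ, φ (ξ 0 z.1, z.2) ∂(P.prod (shockTimeLaw lam T)) := by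
  have := isProbabilityMeasure_shockTimeLaw hN.isIntensity T.coe_nonneg hT
  have hpath : Measurable fun ω t => N t ω := measurable_pi_lambda _ hN.measurable
  have hτ : ∀ i, Measurable fun ω => pathArrivalTime i (fun t => N t ω) := fun i =>
    (measurable_pathArrivalTime i).comp hpath
  have hφξ : ∀ i, Measurable fun ω => φ (ξ i ω, pathArrivalTime i (fun t => N t ω)) := fun i =>
    hφ.comp ((hξ i).prodMk (hτ i))
  have hfiber : ∀ n, MeasurableSet {ω | N T ω = n} := fun n =>
    hN.measurable T (measurableSet_singleton n)
  -- The marginal of the integrand in the mark, which is the same for every index `i`.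
  set ψ : ℝ → ℝ≥0∞ := fun s => ∫⁻ ω, φ (ξ 0 ω, s) ∂P with hψ_def
  have hφ0 : Measurable fun z : Ω × ℝ => φ (ξ 0 z.1, z.2) :=
    hφ.comp (((hξ 0).comp measurable_fst).prodMk measurable_snd)
  have hψ : Measurable ψ := hφ0.lintegral_prod_left'
  have hmark : ∀ i s, ∫⁻ ω, φ (ξ i ω, s) ∂P = ψ s := by
    intro i s
    have hs : Measurable fun e => φ (e, s) := hφ.comp measurable_prodMk_right
    rw [hψ_def, ← lintegral_map hs (hξ i), (hξ_ident i).map_eq, lintegral_map hs (hξ 0)]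
  have hterm : ∀ n i, ∫⁻ ω in {ω | N T ω = n},
      φ (ξ i ω, pathArrivalTime i (fun t => N t ω)) ∂P =
      ∫⁻ s, ψ s ∂((P.restrict {ω | N T ω = n}).map
        (fun ω => pathArrivalTime i (fun t => N t ω))) := by
    intro n i
    set S : Set ((ℕ → E) × (ℝ≥0 → ℕ)) := {z | z.2 T = n} with hS_def
    have hS : MeasurableSet S :=
      measurableSet_eq_fun ((measurable_pi_apply T).comp measurable_snd) measurable_const
    have hf : Measurable (S.indicator fun z => φ (z.1 i, pathArrivalTime i z.2)) := by
      refine Measurable.indicator ?_ hS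
      exact hφ.comp (((measurable_pi_apply i).comp measurable_fst).prodMk
        ((measurable_pathArrivalTime i).comp measurable_snd))
    have h := lintegral_comp_eq_lintegral_lintegral (measurable_pi_lambda _ hξ) hpath hξN hf
    rw [lintegral_map hψ (hτ i), ← lintegral_indicator (hfiber n), ← lintegral_indicator (hfiber n)]
    refine Eq.trans (lintegral_congr fun ω => ?_) (h.trans (lintegral_congr fun ω' => ?_))
    · by_cases hω : N T ω = n
      · rw [Set.indicator_of_mem (by exact hω), Set.indicator_of_mem (by exact hω)]
      · rw [Set.indicator_of_notMem (by exact hω), Set.indicator_of_notMem (by exact hω)]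
    · by_cases hω : N T ω' = n
      · rw [Set.indicator_of_mem (by exact hω), ← hmark i]
        refine lintegral_congr fun ω => ?_
        rw [Set.indicator_of_mem (by exact hω)]
      · rw [Set.indicator_of_notMem (by exact hω), ← lintegral_zero (μ := P)]
        refine lintegral_congr fun ω => ?_
        rw [Set.indicator_of_notMem (by exact hω)]
  have hprod : ∫⁻ z : Ω × ℝ, φ (ξ 0 z.1, z.2) ∂(P.prod (shockTimeLaw lam T)) =
      ∫⁻ s, ψ s ∂(shockTimeLaw lam T) := lintegral_prod_symm _ hφ0.aemeasurable
  rw [hprod, lintegral_eq_tsum_setLIntegral_fiber (hN.measurable T),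
    lintegral_eq_tsum_setLIntegral_fiber (hN.measurable T) (fun ω => w (N T ω) * N T ω),
    ← ENNReal.tsum_mul_right]
  refine tsum_congr fun n => ?_
  have hleft : ∫⁻ ω in {ω | N T ω = n}, w (N T ω) * ∑ i ∈ Finset.Icc 1 (N T ω),
      φ (ξ i ω, pathArrivalTime i (fun t => N t ω)) ∂P =
      ∫⁻ ω in {ω | N T ω = n}, w n * ∑ i ∈ Finset.Icc 1 n,
        φ (ξ i ω, pathArrivalTime i (fun t => N t ω)) ∂P := by
    refine setLIntegral_congr_fun (hfiber n) fun ω hω => ?_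
    have hω : N T ω = n := hω
    simp only [hω]
  have hright : ∫⁻ ω in {ω | N T ω = n}, w (N T ω) * N T ω ∂P =
      ∫⁻ _ in {ω | N T ω = n}, w n * n ∂P := by
    refine setLIntegral_congr_fun (hfiber n) fun ω hω => ?_
    have hω : N T ω = n := hω
    simp only [hω]
  rw [hleft, hright, lintegral_const_mul _ (Finset.measurable_fun_sum _ fun i _ => hφξ i),
    lintegral_finsetSum _ fun i _ => hφξ i, Finset.sum_congr rfl fun i _ => hterm n i,
    ← lintegral_finsetSum_measure, hN.sum_map_pathArrivalTime hT n, lintegral_smul_measure,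
    setLIntegral_const, smul_eq_mul]
  ring

lemma IsInhomogeneousPoissonProcess.ae_arrivalTime_eq
    (hN : IsInhomogeneousPoissonProcess N lam P) (T : ℝ≥0) :
    ∀ᵐ ω ∂P, ∀ i, i ≤ N T ω →
      (arrivalTime N i ω : ℝ) = pathArrivalTime i (fun t => N t ω) := by
  filter_upwards [hN.monotone] with ω hω i hi
  exact (pathArrivalTime_eq_sInf hω ⟨T, hi⟩).symm

/-- The moment assumption on the first shock alone, restricted to the event of exactly one arrival,
already bounds the corresponding moment at the shock time `V_0`. -/
lemma IsInhomogeneousPoissonProcess.lintegral_lt_top_of_first_arrival [IsProbabilityMeasure P]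
    (hN : IsInhomogeneousPoissonProcess N lam P) {T : ℝ≥0} (hT : 0 < cumulativeIntensity lam T)
    {ξ : ℕ → Ω → E} (hξ : ∀ i, Measurable (ξ i)) (hξ_ident : ∀ i, IdentDistrib (ξ i) (ξ 0) P P)
    (hξN : IndepFun (fun ω i => ξ i ω) (fun ω t => N t ω) P)
    {f : E × ℝ → ℝ} (hf : Measurable f)
    (hint : IntegrableOn (fun ω => f (ξ 1 ω, arrivalTime N 1 ω)) {ω | 1 ≤ N T ω} P) :
    ∫⁻ z : Ω × ℝ, ENNReal.ofReal (f (ξ 0 z.1, z.2)) ∂(P.prod (shockTimeLaw lam T)) < ∞ := by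
  have h := hN.lintegral_sum_arrivals hT hξ hξ_ident hξN hf.ennreal_ofReal
    (fun n => if n = 1 then 1 else 0)
  have hfiber : MeasurableSet {ω | N T ω = 1} := hN.measurable T (measurableSet_singleton 1)
  have hge : MeasurableSet {ω | 1 ≤ N T ω} :=
    measurableSet_le measurable_const (hN.measurable T)
  have hmass : ∫⁻ ω, (if N T ω = 1 then 1 else 0) * (N T ω : ℝ≥0∞) ∂P = P {ω | N T ω = 1} := by
    rw [← lintegral_indicator_one hfiber]
    refine lintegral_congr fun ω => ?_
    by_cases hω : N T ω = 1 <;> simp [hω]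
  have hpos : P {ω | N T ω = 1} ≠ 0 := by
    have : 0 < P.real {ω | N T ω = 1} := by
      rw [hN.measureReal_eq]
      positivity
    exact fun h0 => this.ne' (by simp [measureReal_def, h0])
  have hfin : ∫⁻ ω in {ω | 1 ≤ N T ω},
      ENNReal.ofReal (f (ξ 1 ω, arrivalTime N 1 ω)) ∂P < ∞ := Integrable.lintegral_lt_top hint
  have hle : ∫⁻ ω, (if N T ω = 1 then 1 else 0) * ∑ i ∈ Finset.Icc 1 (N T ω),
      ENNReal.ofReal (f (ξ i ω, pathArrivalTime i (fun t => N t ω))) ∂P ≤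
      ∫⁻ ω in {ω | 1 ≤ N T ω}, ENNReal.ofReal (f (ξ 1 ω, arrivalTime N 1 ω)) ∂P := by
    rw [← lintegral_indicator hge]
    refine lintegral_mono_ae ?_
    filter_upwards [hN.ae_arrivalTime_eq T] with ω hω
    by_cases h1 : N T ω = 1
    · rw [Set.indicator_of_mem (by exact h1.ge), hω 1 h1.ge]
      simp [h1]
    · simp [h1]
  rw [h, hmass] at hle
  by_contra hcon
  rw [not_lt, top_le_iff] at hcon
  rw [hcon, ENNReal.mul_top hpos] at hle
  exact absurd hfin (not_lt.2 hle)

end Campbell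

lemma UniformTailIndependent.tendsto_pair {Ω : Type*} [MeasurableSpace Ω] {P : Measure Ω}
    {X : ℕ → Ω → ℝ} (h : UniformTailIndependent X P) {i j : ℕ} (hi : 1 ≤ i) (hj : 1 ≤ j)
    (hij : i ≠ j) :
    Tendsto (fun x => P.real {ω | x < X i ω ∧ x < X j ω} / P.real {ω | x < X 1 ω}) atTop
      (𝓝 0) := by
  have h1 : Tendsto (fun x => P {ω | x < X i ω ∧ x < X j ω} / P {ω | x < X 1 ω}) atTop (𝓝 0) := by
    refine tendsto_of_tendsto_of_tendsto_of_le_of_le tendsto_const_nhds h (fun _ => zero_le)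
      fun x => ?_
    exact le_iSup_of_le i (le_iSup_of_le j (le_iSup_of_le hi (le_iSup_of_le hj
      (le_iSup_of_le hij le_rfl))))
  have h2 := (ENNReal.tendsto_toReal ENNReal.zero_ne_top).comp h1
  rw [ENNReal.toReal_zero] at h2
  refine h2.congr fun x => ?_
  rw [Function.comp_apply, ENNReal.toReal_div]
  rfl

/-! ### Randomly weighted sums -/

section RandomWeights

variable {Ω E : Type*} [MeasurableSpace Ω] {P : Measure Ω}
  {N : ℝ≥0 → Ω → ℕ} {lam : ℝ → ℝ}

/-- The shot noise sum as a functional of the shocks, the parameters of the shock functions and the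
path of the counting process. -/
def shotSum (h : E → ℝ → ℝ → ℝ) (T : ℝ≥0)
    (z : (ℕ → ℝ) × ((ℕ → E) × (ℝ≥0 → ℕ))) : ℝ :=
  ∑ i ∈ Finset.Icc 1 (z.2.2 T), z.1 i * h (z.2.1 i) T (pathArrivalTime i z.2.2)

lemma measurable_shotSum [MeasurableSpace E] {h : E → ℝ → ℝ → ℝ}
    (hh : ∀ t, Measurable (fun z : E × ℝ => h z.1 t z.2)) (T : ℝ≥0) :
    Measurable (shotSum h T) := by
  refine measurable_sum_Icc ((measurable_pi_apply T).comp (by fun_prop)) fun i => ?_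
  have hmark : Measurable fun z : (ℕ → ℝ) × ((ℕ → E) × (ℝ≥0 → ℕ)) =>
      (z.2.1 i, pathArrivalTime i z.2.2) :=
    ((measurable_pi_apply i).comp (measurable_fst.comp measurable_snd)).prodMk
      ((measurable_pathArrivalTime i).comp (measurable_snd.comp measurable_snd))
  exact ((measurable_pi_apply i).comp measurable_fst).mul ((hh T).comp hmark)

lemma IsInhomogeneousPoissonProcess.ae_shotNoise_eq
    (hN : IsInhomogeneousPoissonProcess N lam P) (X : ℕ → Ω → ℝ) (h : E → ℝ → ℝ → ℝ)
    (ξ : ℕ → Ω → E) (T : ℝ≥0) :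
    ∀ᵐ ω ∂P, shotNoise N X h ξ T ω =
      shotSum h T (fun i => X i ω, fun i => ξ i ω, fun t => N t ω) := by
  filter_upwards [hN.ae_arrivalTime_eq T] with ω hω
  refine Finset.sum_congr rfl fun i hi => ?_
  rw [hω i (Finset.mem_Icc.1 hi).2]

/-- For two independent random elements, the probability of an event is the average of its
probabilities with one of the elements frozen. -/
lemma integral_measureReal_frozen [IsProbabilityMeasure P] {A B : Type*} [MeasurableSpace A]
    [MeasurableSpace B] {U : Ω → A} {W : Ω → B} (hU : Measurable U) (hW : Measurable W)
    (hUW : IndepFun U W P) {S : Set (A × B)} (hS : MeasurableSet S) :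
    AEStronglyMeasurable (fun ω' => P.real {ω | (U ω, W ω') ∈ S}) P ∧
      ∫ ω', P.real {ω | (U ω, W ω') ∈ S} ∂P = P.real {ω | (U ω, W ω) ∈ S} := by
  have hmeas : Measurable fun ω' => P {ω | (U ω, W ω') ∈ S} := by
    have : MeasurableSet {q : Ω × Ω | (U q.2, W q.1) ∈ S} :=
      ((hU.comp measurable_snd).prodMk (hW.comp measurable_fst)) hS
    exact measurable_measure_prodMk_left this
  refine ⟨hmeas.ennreal_toReal.aestronglyMeasurable, ?_⟩
  have h := lintegral_comp_eq_lintegral_lintegral hU hW hUW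
    (measurable_one.indicator hS : Measurable (S.indicator (1 : A × B → ℝ≥0∞)))
  have h1 : ∀ V : Ω → B, Measurable V → ∫⁻ ω, S.indicator (1 : A × B → ℝ≥0∞) (U ω, V ω) ∂P =
      P {ω | (U ω, V ω) ∈ S} := by
    intro V hV
    exact lintegral_indicator_one ((hU.prodMk hV) hS)
  rw [h1 W hW, lintegral_congr fun ω' => h1 (fun _ => W ω') measurable_const] at h
  have h2 := integral_toReal (μ := P) hmeas.aemeasurable
    (Eventually.of_forall fun ω' => measure_lt_top P {ω | (U ω, W ω') ∈ S})
  exact h2.trans (congrArg ENNReal.toReal h.symm)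

end RandomWeights

end ShotNoise

end

theorem corollary4p1 {Ω E : Type*} [MeasurableSpace Ω] [MeasurableSpace E]
    (P : Measure Ω) [IsProbabilityMeasure P]
    -- the inhomogeneous Poisson process, with cumulative intensity positive at the time `T`
    (N : ℝ≥0 → Ω → ℕ) (lam : ℝ → ℝ)
    (hN : ShotNoise.IsInhomogeneousPoissonProcess N lam P)
    (T : ℝ≥0) (hT : 0 < ShotNoise.cumulativeIntensity lam T)
    -- the shocks: nonnegative, identically distributed, regularly varying, asymptotically
    -- independent
    (X : ℕ → Ω → ℝ) (hX_meas : ∀ i, Measurable (X i)) (hX_nonneg : ∀ i, 0 ≤ᵐ[P] X i)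
    (hX_ident : ∀ i, IdentDistrib (X i) (X 1) P P)
    (α : ℝ) (hα : 0 < α)
    (hX_rv : ShotNoise.RegularlyVarying (fun x => P.real {ω | x < X 1 ω}) (-α))
    (hX_indep : ShotNoise.UniformTailIndependent X P)
    -- the i.i.d. nonnegative measurable random shock functions `h_i(t, v) = h (ξ i) t v`
    (h : E → ℝ → ℝ → ℝ) (hh_nonneg : ∀ e t v, 0 ≤ h e t v)
    (hh_meas : ∀ t, Measurable (fun z : E × ℝ => h z.1 t z.2))
    (ξ : ℕ → Ω → E) (hξ_meas : ∀ i, Measurable (ξ i))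
    (hξ_indep : iIndepFun ξ P) (hξ_ident : ∀ i, IdentDistrib (ξ i) (ξ 0) P P)
    -- shock functions, arrival times and shocks are independent of each other
    (hξN : IndepFun (fun ω i => ξ i ω) (fun ω t => N t ω) P)
    (hXξN : IndepFun (fun ω i => X i ω) (fun ω => (fun i => ξ i ω, fun t => N t ω)) P)
    -- the shock functions are integrable of an order `p > α` at the arrival times up to `T`
    (p : ℝ) (hp : α < p)
    (hh_int : ∀ i, 1 ≤ i →
      IntegrableOn (fun ω => h (ξ i ω) T (ShotNoise.arrivalTime N i ω) ^ p)
        {ω | i ≤ N T ω} P) :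
    -- `z = (ω, v)` is distributed as `P ⊗ law of V_0`, so `V_0` is independent of `h_0`
    Integrable (fun z : Ω × ℝ => h (ξ 0 z.1) T z.2 ^ α)
        (P.prod (ShotNoise.shockTimeLaw lam T)) ∧
      Tendsto
        (fun x : ℝ => P.real {ω | x < ShotNoise.shotNoise N X h ξ T ω} / P.real {ω | x < X 1 ω})
        atTop
        (𝓝 (ShotNoise.cumulativeIntensity lam T *
          ∫ z : Ω × ℝ, h (ξ 0 z.1) T z.2 ^ α ∂(P.prod (ShotNoise.shockTimeLaw lam T)))) := by
  open ShotNoise in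
  have := isProbabilityMeasure_shockTimeLaw hN.isIntensity T.coe_nonneg hT
  set F : ℝ → ℝ := fun x => P.real {ω | x < X 1 ω}
  have hF_anti : Antitone F := fun x y hxy =>
    measureReal_mono (fun ω hω => lt_of_le_of_lt hxy hω) (measure_ne_top _ _)
  have hF_le : ∀ x, F x ≤ 1 := fun x => measureReal_le_one
  have hF_pos := hX_rv.pos_of_antitone hF_anti
  have htail : ∀ i x, P.real {ω | x < X i ω} = F x := fun i x =>
    congrArg ENNReal.toReal ((hX_ident i).measure_mem_eq (measurableSet_Ioi (a := x)))
  have hpath : Measurable fun ω t => N t ω := measurable_pi_lambda _ hN.measurable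
  have hg_meas : Measurable fun z : Ω × ℝ => h (ξ 0 z.1) T z.2 :=
    (hh_meas T).comp (((hξ_meas 0).comp measurable_fst).prodMk measurable_snd)
  -- The moment of order `p` at the shock time, and hence integrability of the power `α`.
  have hmoment := hN.lintegral_lt_top_of_first_arrival hT hξ_meas hξ_ident hξN
    (f := fun z => h z.1 T z.2 ^ p) ((hh_meas T).pow_const p) (hh_int 1 le_rfl)
  have hint_p : Integrable (fun z : Ω × ℝ => h (ξ 0 z.1) T z.2 ^ p)
      (P.prod (shockTimeLaw lam T)) := by
    refine ⟨(hg_meas.pow_const p).aestronglyMeasurable, ?_⟩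
    rw [hasFiniteIntegral_iff_ofReal
      (Eventually.of_forall fun z => Real.rpow_nonneg (hh_nonneg _ _ _) p)]
    exact hmoment
  have hint : Integrable (fun z : Ω × ℝ => h (ξ 0 z.1) T z.2 ^ α)
      (P.prod (shockTimeLaw lam T)) := by
    refine ((integrable_const (1 : ℝ)).add hint_p).mono'
      (hg_meas.pow_const α).aestronglyMeasurable (Eventually.of_forall fun z => ?_)
    have hz := hh_nonneg (ξ 0 z.1) T z.2
    rw [Real.norm_of_nonneg (Real.rpow_nonneg hz α), Pi.add_apply]
    rcases le_total (h (ξ 0 z.1) T z.2) 1 with h1 | h1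
    · have := Real.rpow_le_one hz h1 hα.le
      have := Real.rpow_nonneg hz p
      linarith
    · have := Real.rpow_le_rpow_of_exponent_le h1 hp.le
      linarith
  refine ⟨hint, ?_⟩
  set θ : Ω → ℕ → ℝ := fun ω i => h (ξ i ω) T (pathArrivalTime i fun t => N t ω)
  have hθ_nonneg : ∀ ω i, 0 ≤ θ ω i := fun ω i => hh_nonneg _ _ _
  have hθ_meas : ∀ i, Measurable fun ω => θ ω i := fun i =>
    (hh_meas T).comp ((hξ_meas i).prodMk ((measurable_pathArrivalTime i).comp hpath))
  -- The tail of the shot noise with the weights frozen at `ω'`.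
  set G : ℝ → Ω → ℝ := fun x ω' =>
    P.real {ω | x < ∑ i ∈ Finset.Icc 1 (N T ω'), X i ω * θ ω' i}
  have hfrozen : ∀ x, AEStronglyMeasurable (G x) P ∧
      ∫ ω', G x ω' ∂P = P.real {ω | x < shotNoise N X h ξ T ω} := by
    intro x
    have hS : MeasurableSet {z | x < shotSum h T z} :=
      measurableSet_lt measurable_const (measurable_shotSum hh_meas T)
    obtain ⟨h1, h2⟩ := integral_measureReal_frozen (measurable_pi_lambda _ hX_meas)
      ((measurable_pi_lambda _ hξ_meas).prodMk hpath) hXξN hS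
    refine ⟨h1, h2.trans (measureReal_congr ?_)⟩
    filter_upwards [hN.ae_shotNoise_eq X h ξ T] with ω hω
    refine propext ?_
    change x < shotSum h T _ ↔ x < shotNoise N X h ξ T ω
    rw [hω]
  -- The limit, evaluated by Campbell's formula.
  have hlimit : ∫ ω, ∑ i ∈ Finset.Icc 1 (N T ω), θ ω i ^ α ∂P =
      cumulativeIntensity lam T *
        ∫ z : Ω × ℝ, h (ξ 0 z.1) T z.2 ^ α ∂(P.prod (shockTimeLaw lam T)) := by
    have hC := hN.lintegral_sum_arrivals hT hξ_meas hξ_ident hξN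
      (φ := fun z => ENNReal.ofReal (h z.1 T z.2 ^ α))
      ((hh_meas T).pow_const α).ennreal_ofReal (fun _ => 1)
    simp only [one_mul] at hC
    rw [hN.lintegral_natCast] at hC
    rw [integral_eq_lintegral_of_nonneg_ae, integral_eq_lintegral_of_nonneg_ae
      (Eventually.of_forall fun z => Real.rpow_nonneg (hh_nonneg _ _ _) α)
      hint.aestronglyMeasurable]
    · refine Eq.trans ?_ ((congrArg ENNReal.toReal hC).trans ?_)
      swap
      · rw [ENNReal.toReal_mul, ENNReal.toReal_ofReal hT.le]
      congr 1
      refine lintegral_congr fun ω => ?_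
      exact ENNReal.ofReal_sum_of_nonneg fun i _ => Real.rpow_nonneg (hθ_nonneg ω i) α
    · exact Eventually.of_forall fun ω =>
        Finset.sum_nonneg fun i _ => Real.rpow_nonneg (hθ_nonneg ω i) α
    · exact (measurable_sum_Icc (hN.measurable T)
        fun i => (hθ_meas i).pow_const α).aestronglyMeasurable
  obtain ⟨C, x₀, hC, hx₀, hbound⟩ := hX_rv.exists_forall_div_le hF_anti hF_le hα hp
  set k : ℕ := ⌈p⌉₊
  have hpk : p ≤ k := Nat.le_ceil p
  -- The majorant; a natural exponent `k ≥ p` on the count keeps to integer Poisson moments.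
  set B : Ω → ℝ := fun ω => ∑ i ∈ Finset.Icc 1 (N T ω), C * (N T ω : ℝ) ^ k * (1 + θ ω i ^ p)
    with hB_def
  have hB_int : Integrable B P := by
    have hmeasN : Measurable fun ω => (N T ω : ℝ) :=
      measurable_from_nat.comp (hN.measurable T)
    refine ⟨(measurable_sum_Icc (hN.measurable T) fun i =>
      (measurable_const.mul (hmeasN.pow_const k)).mul
        (measurable_const.add ((hθ_meas i).pow_const p))).aestronglyMeasurable, ?_⟩
    have hterm : ∀ ω i, 0 ≤ 1 + θ ω i ^ p := fun ω i =>
      add_nonneg zero_le_one (Real.rpow_nonneg (hθ_nonneg ω i) p)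
    rw [hasFiniteIntegral_iff_ofReal (Eventually.of_forall fun ω =>
      Finset.sum_nonneg fun i _ => mul_nonneg (by positivity) (hterm ω i))]
    have hCamp := hN.lintegral_sum_arrivals hT hξ_meas hξ_ident hξN
      (φ := fun z => ENNReal.ofReal (1 + h z.1 T z.2 ^ p))
      (measurable_const.add ((hh_meas T).pow_const p)).ennreal_ofReal
      (fun n => ENNReal.ofReal C * (n : ℝ≥0∞) ^ k)
    have heq : ∫⁻ ω, ENNReal.ofReal (B ω) ∂P = ∫⁻ ω, ENNReal.ofReal C * (N T ω : ℝ≥0∞) ^ k *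
        ∑ i ∈ Finset.Icc 1 (N T ω), ENNReal.ofReal (1 + θ ω i ^ p) ∂P := by
      refine lintegral_congr fun ω => ?_
      rw [hB_def, ← ENNReal.ofReal_sum_of_nonneg fun i _ => hterm ω i]
      simp only
      rw [← Finset.mul_sum, ENNReal.ofReal_mul (by positivity), ENNReal.ofReal_mul hC.le,
        ENNReal.ofReal_pow (Nat.cast_nonneg _), ENNReal.ofReal_natCast]
    rw [heq, hCamp]
    refine ENNReal.mul_lt_top ?_ (Integrable.lintegral_lt_top ((integrable_const 1).add hint_p))
    simp_rw [mul_assoc, ← pow_succ]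
    rw [lintegral_const_mul' _ _ ENNReal.ofReal_ne_top]
    exact ENNReal.mul_lt_top ENNReal.ofReal_lt_top (hN.lintegral_pow_lt_top T (k + 1))
  rw [← hlimit]
  have hratio : ∀ x, ∫ ω, G x ω / F x ∂P = P.real {ω | x < shotNoise N X h ξ T ω} / F x :=
    fun x => by rw [integral_div, (hfrozen x).2]
  refine Tendsto.congr hratio ?_
  refine tendsto_integral_filter_of_dominated_convergence B ?_ ?_ hB_int ?_
  · exact Eventually.of_forall fun x => by
      simpa only [div_eq_mul_inv] using (hfrozen x).1.mul_const (F x)⁻¹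
  · filter_upwards [eventually_ge_atTop x₀] with x hx
    refine Eventually.of_forall fun ω => ?_
    rw [Real.norm_of_nonneg (div_nonneg measureReal_nonneg (hF_pos x).le), div_le_iff₀ (hF_pos x)]
    refine (tail_sum_le (hθ_nonneg ω) (fun i _ => htail i) (hx₀.trans_le hx) hC.le (hF_pos x).le
      (hbound x hx)).trans ?_
    refine mul_le_mul_of_nonneg_right (Finset.sum_le_sum fun i hi => ?_) (hF_pos x).le
    have hn : (1 : ℝ) ≤ N T ω := by
      have := Finset.mem_Icc.1 hi
      exact_mod_cast this.1.trans this.2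
    rw [Nat.card_Icc, Nat.add_sub_cancel, Real.mul_rpow (Nat.cast_nonneg _) (hθ_nonneg ω i),
      mul_assoc]
    have h1 : (N T ω : ℝ) ^ p ≤ (N T ω : ℝ) ^ k := by
      rw [← Real.rpow_natCast]
      exact Real.rpow_le_rpow_of_exponent_le hn hpk
    have h2 : (1 : ℝ) ≤ (N T ω : ℝ) ^ k := one_le_pow₀ hn
    have h3 := Real.rpow_nonneg (hθ_nonneg ω i) p
    have h4 := mul_le_mul_of_nonneg_left (add_le_add h2 (mul_le_mul_of_nonneg_right h1 h3)) hC.le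
    linarith
  · refine Eventually.of_forall fun ω => ?_
    refine tendsto_tail_sum_div hX_meas hX_nonneg hX_rv hα (hθ_nonneg ω) _
      (fun i _ => htail i) fun i hi j hj hij => ?_
    exact hX_indep.tendsto_pair (Finset.mem_Icc.1 hi).1 (Finset.mem_Icc.1 hj).1 hij
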